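/- Let $(\mathfrak g,\cdot)$ be a complex (left) pre-Lie algebra, i.e. $(x\cdot y)\cdot z-x\cdot(y\cdot z)=(y\cdot x)\cdot z-y\cdot(x\cdot z)$, and put $[x,y]_{\mathfrak g}=x\cdot y-y\cdot x$. Let $(V;\mathcal L,\mathcal R)$ be a representation of $\mathfrak g$, i.e. a complex vector space $V$ with linear maps $\mathcal L,\mathcal R:\mathfrak g\to\mathfrak{gl}(V)$ such that $\mathcal L_x\mathcal L_y-\mathcal L_{x\cdot y}=\mathcal L_y\mathcal L_x-\mathcal L_{y\cdot x}$ and $\mathcal L_x\mathcal R_y-\mathcal R_y\mathcal L_x=\mathcal R_{x\cdot y}-\mathcal R_y\mathcal R_x$. Let $H:\mathfrak g\otimes\mathfrak g\to V$ be a $2$-cocycle, i.e. a bilinear map with $$\mathcal L_xH(y,z)-\mathcal L_yH(x,z)+\mathcal R_zH(y,x)-\mathcal R_zH(x,y)-H(y,x\cdot z)+H(x,y\cdot z)-H([x,y]_{\mathfrak g},z)=0 .$$ A linear map $K:V\to\mathfrak g$ is a *relative cocycle weighted (RCW) Reynolds operator* (with weight $H$) if $$Ku\cdot Kv=K\big(\mathcal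 L_{Ku}v+\mathcal R_{Kv}u+H(Ku,Kv)\big)\qquad(u,v\in V).$$ For a vector space $W$, $P\in\mathrm{Hom}(\wedge^{p}W\otimes W,W)$ and $Q\in\mathrm{Hom}(\wedge^{q}W\otimes W,W)$, let $[P,Q]^{MN}=P\diamond Q-(-1)^{pq}Q\diamond P$ be the Matsushima–Nijenhuis bracket, where $$\begin{aligned}(P\diamond Q)(x_1,\dots,x_{p+q+1})={}&\sum_{\sigma\in\mathbb S_{(q,1,p-1)}}\mathrm{sgn}(\sigma)\,P\big(Q(x_{\sigma(1)},\dots,x_{\sigma(q+1)}),x_{\sigma(q+2)},\dots,x_{\sigma(p+q)},x_{p+q+1}\big)\\&+(-1)^{pq}\sum_{\sigma\in\mathbb S_{(p,q)}}\mathrm{sgn}(\sigma)\,P\big(x_{\sigma(1)},\dots,x_{\sigma(p)},Q(x_{\sigma(p+1)},\dots,x_{\sigma(p+q)},x_{p+q+1})\big)\end{aligned}$$ (sums over unshuffles; the first sum is empty if $p=0$). Put $C^n=\mathrm{Hom}(\wedge^{n-1}V\otimes V,\mathfrak g)$ for $n\ge1$, in degree $n$, regarded as a subspace of $\mathrm{Hom}(\wedge^{n-1}W\otimes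 W,W)$ for $W=\mathfrak g\oplus V$ (extension by zero). Let $\theta,\widehat H:W\otimes W\to W$ be $\theta\big((x,u),(y,v)\big)=(x\cdot y,\ \mathcal L_xv+\mathcal R_yu)$ and $\widehat H\big((x,u),(y,v)\big)=(0,H(x,y))$. For $P\in C^p$, $Q\in C^q$, $R\in C^r$ define $$\llbracket P,Q\rrbracket=(-1)^{p-1}\big[[\theta,P]^{MN},Q\big]^{MN}\in C^{p+q},\qquad \llbracket P,Q,R\rrbracket=(-1)^{q-1}\big[[[\widehat H,P]^{MN},Q]^{MN},R\big]^{MN}\in C^{p+q+r-1}.$$ Let $K:V\to\mathfrak g$ be an RCW Reynolds operator. The $L_\infty$-algebra twisted by $K$ is $\bigoplus_{n\ge1}C^n$ with the structure maps $$l_1(P)=d_K(P)=\llbracket K,P\rrbracket+\tfrac12\llbracket K,K,P\rrbracket,\qquad l_2(P,Q)=\llbracket P,Q\rrbracket+\llbracket K,P,Q\rrbracket,\qquad l_3(P,Q,R)=\llbracket P,Q,R\rrbracket,$$ and $l_k=0$ for $k\ge4$. An element $\alpha\in C^1=\mathrm{Hom}(V,\mathfrak g)$ is a Maurer–Cartan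 element of it if $$l_1(\alpha)+\tfrac1{2!}\,l_2(\alpha,\alpha)+\tfrac1{3!}\,l_3(\alpha,\alpha,\alpha)=0 .$$ **Theorem.** For every linear map $K':V\to\mathfrak g$, the sum $K+K'$ is an RCW Reynolds operator if and only if $K'$ is a Maurer–Cartan element of the $L_\infty$-algebra twisted by $K$. -/

import Mathlib

/-- A representation `(V; L, R)` of a (left) pre-Lie algebra `g`. -/
structure PreLieRep (g V : Type*) [LeftPreLieRing g] [LeftPreLieAlgebra ℂ g]
    [AddCommGroup V] [Module ℂ V] where
  /-- the left action `x ↦ L_x` -/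
  L : g →ₗ[ℂ] V →ₗ[ℂ] V
  /-- the right action `x ↦ R_x` -/
  R : g →ₗ[ℂ] V →ₗ[ℂ] V
  left_left : ∀ (x y : g) (u : V),
    L x (L y u) - L (x * y) u = L y (L x u) - L (y * x) u
  left_right : ∀ (x y : g) (u : V),
    L x (R y u) - R y (L x u) = R (x * y) u - R y (R x u)

/-- `H : g ⊗ g → V` is a 2-cocycle of the pre-Lie algebra `g` with coefficients in `V`. -/
def IsTwoCocycle {g V : Type*} [LeftPreLieRing g] [LeftPreLieAlgebra ℂ g]
    [AddCommGroup V] [Module ℂ V] (ρ : PreLieRep g V) (H : g →ₗ[ℂ] g →ₗ[ℂ] V) : Prop :=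
  ∀ x y z : g,
    ρ.L x (H y z) - ρ.L y (H x z) + ρ.R z (H y x) - ρ.R z (H x y)
      - H y (x * z) + H x (y * z) - H (x * y - y * x) z = 0

/-- `K : V → g` is a relative cocycle weighted (RCW) Reynolds operator with weight `H`. -/
def IsRCWReynolds {g V : Type*} [LeftPreLieRing g] [LeftPreLieAlgebra ℂ g]
    [AddCommGroup V] [Module ℂ V] (ρ : PreLieRep g V) (H : g →ₗ[ℂ] g →ₗ[ℂ] V)
    (K : V →ₗ[ℂ] g) : Prop :=
  ∀ u v : V, K u * K v = K (ρ.L (K u) v + ρ.R (K v) u + H (K u) (K v))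

/-- `PLCochain M N n` is `Hom(∧ⁿM ⊗ M, N)`: maps in `n + 1` arguments, alternating in the first
`n` ones.  `P x y` is the value at `x₁ ∧ ⋯ ∧ xₙ ⊗ y`. -/
abbrev PLCochain (M N : Type*) [AddCommGroup M] [Module ℂ M] [AddCommGroup N] [Module ℂ N]
    (n : ℕ) : Type _ :=
  M [⋀^Fin n]→ₗ[ℂ] (M →ₗ[ℂ] N)

namespace PLCochain

section General

variable {M N : Type*} [AddCommGroup M] [Module ℂ M] [AddCommGroup N] [Module ℂ N]

/-- Transport along an equality of degrees. -/
def cast {m n : ℕ} (h : m = n) (P : PLCochain M N m) : PLCochain M N n :=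
  AlternatingMap.domDomCongr (finCongr h) P

/-- The antisymmetrisation of `Q ∈ Hom(∧^q M ⊗ M, M)` over all of its `q + 1` arguments:
`(x₁, …, x_{q+1}) ↦ ∑_σ sgn(σ) Q(x_{σ(1)}, …, x_{σ(q)}, x_{σ(q+1)})`
over the `(q, 1)`-unshuffles `σ`. (`AlternatingMap.domCoprod` is the sum over unshuffles.) -/
noncomputable def hat {q : ℕ} (Q : PLCochain M M q) : M [⋀^Fin q ⊕ Fin 1]→ₗ[ℂ] M :=
  (TensorProduct.lift (LinearMap.id : (M →ₗ[ℂ] M) →ₗ[ℂ] (M →ₗ[ℂ] M))).compAlternatingMap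
    (AlternatingMap.domCoprod Q (AlternatingMap.ofSubsingleton ℂ M M (0 : Fin 1) LinearMap.id))

/-- `P ∈ Hom(∧^{p+1} M ⊗ M, N)` regarded as the alternating map sending `x₁, …, x_p` to
`w ↦ y ↦ P(w, x₁, …, x_p, y)`. -/
def splitFirst {p : ℕ} (P : PLCochain M N (p + 1)) :
    M [⋀^Fin p]→ₗ[ℂ] (M →ₗ[ℂ] M →ₗ[ℂ] N) where
  toFun x :=
    { toFun := fun w => P.curryLeft w x
      map_add' := fun a b => by rw [map_add]; rfl
      map_smul' := fun c a => by rw [map_smul]; rfl }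
  map_update_add' x i a b := LinearMap.ext fun w => (P.curryLeft w).map_update_add x i a b
  map_update_smul' x i c a := LinearMap.ext fun w => (P.curryLeft w).map_update_smul x i c a
  map_eq_zero_of_eq' x _ _ hx hij :=
    LinearMap.ext fun w => (P.curryLeft w).map_eq_zero_of_eq x hx hij

theorem splitFirst_apply {p : ℕ} (P : PLCochain M N (p + 1)) (x : Fin p → M) (w y : M) :
    splitFirst P x w y = P (Fin.cons w x) y := rfl

/-- The sum over the `(q, 1, p-1)`-unshuffles `σ` of
`sgn(σ) P(Q(x_{σ(1)}, …, x_{σ(q)}, x_{σ(q+1)}), x_{σ(q+2)}, …, x_{σ(p+q)}, y)`; it is empty for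
`p = 0`. -/
noncomputable def insertFirst : {p q : ℕ} → PLCochain M M p → PLCochain M M q →
    PLCochain M M (p + q)
  | 0, _, _, _ => 0
  | p + 1, q, P, Q =>
    AlternatingMap.domDomCongr
      (((Equiv.sumCongr finSumFinEquiv (Equiv.refl (Fin p))).trans finSumFinEquiv).trans
        (finCongr (by omega)))
      ((TensorProduct.lift (LinearMap.id : (M →ₗ[ℂ] M →ₗ[ℂ] M) →ₗ[ℂ] _).flip).compAlternatingMap
        (AlternatingMap.domCoprod (hat Q) (splitFirst P)))

/-- The sum over the `(p, q)`-unshuffles `σ` of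
`sgn(σ) P(x_{σ(1)}, …, x_{σ(p)}, Q(x_{σ(p+1)}, …, x_{σ(p+q)}, y))`. -/
noncomputable def insertLast {p q : ℕ} (P : PLCochain M M p) (Q : PLCochain M M q) :
    PLCochain M M (p + q) :=
  AlternatingMap.domDomCongr finSumFinEquiv
    ((LinearMap.mul' ℂ (Module.End ℂ M)).compAlternatingMap (AlternatingMap.domCoprod P Q))

/-- The product `P ⋄ Q`. -/
noncomputable def diamond {p q : ℕ} (P : PLCochain M M p) (Q : PLCochain M M q) :
    PLCochain M M (p + q) :=
  insertFirst P Q + (-1 : ℂ) ^ (p * q) • insertLast P Q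

/-- The Matsushima-Nijenhuis bracket `[P, Q] = P ⋄ Q - (-1)^{pq} Q ⋄ P`. -/
noncomputable def mnBracket {p q : ℕ} (P : PLCochain M M p) (Q : PLCochain M M q) :
    PLCochain M M (p + q) :=
  diamond P Q - (-1 : ℂ) ^ (p * q) • cast (Nat.add_comm q p) (diamond Q P)

/-- A bilinear map `M ⊗ M → N` as an element of `Hom(∧¹M ⊗ M, N)`. -/
def ofBilin (B : M →ₗ[ℂ] M →ₗ[ℂ] N) : PLCochain M N 1 :=
  AlternatingMap.ofSubsingleton ℂ M (M →ₗ[ℂ] N) (0 : Fin 1) B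

/-- A linear map `M → N` as an element of `Hom(∧⁰M ⊗ M, N)`. -/
def ofLinear (K : M →ₗ[ℂ] N) : PLCochain M N 0 :=
  AlternatingMap.constOfIsEmpty ℂ M (Fin 0) K

end General

section Brackets

variable {g V : Type*} [LeftPreLieRing g] [LeftPreLieAlgebra ℂ g]
  [AddCommGroup V] [Module ℂ V]

/-- The inclusion of `Hom(∧ⁿV ⊗ V, g)` in `Hom(∧ⁿ(g ⊕ V) ⊗ (g ⊕ V), g ⊕ V)`: extension by zero. -/
def lift {n : ℕ} (P : PLCochain V g n) : PLCochain (g × V) (g × V) n :=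
  (LinearMap.compAlternatingMap
    ((LinearMap.lcomp ℂ (g × V) (LinearMap.snd ℂ g V)).comp
      (LinearMap.llcomp ℂ V g (g × V) (LinearMap.inl ℂ g V))) P).compLinearMap
    (LinearMap.snd ℂ g V)

/-- The component in `Hom(∧ⁿV ⊗ V, g)` of an element of
`Hom(∧ⁿ(g ⊕ V) ⊗ (g ⊕ V), g ⊕ V)`. -/
def restrict {n : ℕ} (P : PLCochain (g × V) (g × V) n) : PLCochain V g n :=
  (LinearMap.compAlternatingMap
    ((LinearMap.lcomp ℂ g (LinearMap.inr ℂ g V)).comp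
      (LinearMap.llcomp ℂ (g × V) (g × V) g (LinearMap.fst ℂ g V))) P).compLinearMap
    (LinearMap.inr ℂ g V)

theorem lift_apply {n : ℕ} (P : PLCochain V g n) (x : Fin n → g × V) (y : g × V) :
    lift P x y = (P (fun i => (x i).2) y.2, 0) := rfl

theorem restrict_apply {n : ℕ} (P : PLCochain (g × V) (g × V) n) (x : Fin n → V) (y : V) :
    restrict P x y = (P (fun i => (0, x i)) (0, y)).1 := rfl

/-- `π + L + R`: the product `(x, u)(y, v) = (x y, L_x v + R_y u)` on `g ⊕ V`. -/
noncomputable def semidirect (ρ : PreLieRep g V) : PLCochain (g × V) (g × V) 1 :=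
  ofBilin (LinearMap.mk₂ ℂ
    (fun a b : g × V => (a.1 * b.1, ρ.L a.1 b.2 + ρ.R b.1 a.2))
    (fun a b c => by ext <;> simp [add_mul, add_add_add_comm])
    (fun c a b => by ext <;> simp [smul_mul_assoc])
    (fun a b c => by ext <;> simp [mul_add, add_add_add_comm])
    (fun c a b => by ext <;> simp [mul_smul_comm]))

/-- `H` as the bilinear map `((x, u), (y, v)) ↦ (0, H(x, y))` on `g ⊕ V`. -/
noncomputable def weight (H : g →ₗ[ℂ] g →ₗ[ℂ] V) : PLCochain (g × V) (g × V) 1 :=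
  ofBilin (LinearMap.mk₂ ℂ (fun a b : g × V => ((0 : g), H a.1 b.1))
    (fun a b c => by ext <;> simp)
    (fun c a b => by ext <;> simp)
    (fun a b c => by ext <;> simp)
    (fun c a b => by ext <;> simp))

/-- The binary bracket `⟦P, Q⟧ = (-1)^p [[π + L + R, P], Q]` for `P ∈ Hom(∧^p V ⊗ V, g)` and
`Q ∈ Hom(∧^q V ⊗ V, g)`. -/
noncomputable def binary (ρ : PreLieRep g V) {p q : ℕ} (P : PLCochain V g p)
    (Q : PLCochain V g q) : PLCochain V g (p + q + 1) :=
  (-1 : ℂ) ^ p •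
    cast (by omega) (restrict (mnBracket (mnBracket (semidirect ρ) (lift P)) (lift Q)))

/-- The ternary bracket `⟦P, Q, R⟧ = (-1)^q [[[H, P], Q], R]` for `P ∈ Hom(∧^p V ⊗ V, g)`,
`Q ∈ Hom(∧^q V ⊗ V, g)` and `R ∈ Hom(∧^r V ⊗ V, g)`. -/
noncomputable def ternary (H : g →ₗ[ℂ] g →ₗ[ℂ] V) {p q r : ℕ} (P : PLCochain V g p)
    (Q : PLCochain V g q) (R : PLCochain V g r) : PLCochain V g (p + q + r + 1) :=
  (-1 : ℂ) ^ q •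
    cast (by omega)
      (restrict (mnBracket (mnBracket (mnBracket (weight H) (lift P)) (lift Q)) (lift R)))

/-- `l₁` of the structure twisted by `K`: `d_K(P) = ⟦K, P⟧ + ½ ⟦K, K, P⟧`. -/
noncomputable def twistedUnary (ρ : PreLieRep g V) (H : g →ₗ[ℂ] g →ₗ[ℂ] V) (K : V →ₗ[ℂ] g)
    {p : ℕ} (P : PLCochain V g p) : PLCochain V g (p + 1) :=
  cast (by omega) (binary ρ (ofLinear K) P) +
    (1 / 2 : ℂ) • cast (by omega) (ternary H (ofLinear K) (ofLinear K) P)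

/-- `l₂` of the structure twisted by `K`: `⟦P, Q⟧_K = ⟦P, Q⟧ + ⟦K, P, Q⟧`. -/
noncomputable def twistedBinary (ρ : PreLieRep g V) (H : g →ₗ[ℂ] g →ₗ[ℂ] V) (K : V →ₗ[ℂ] g)
    {p q : ℕ} (P : PLCochain V g p) (Q : PLCochain V g q) : PLCochain V g (p + q + 1) :=
  binary ρ P Q + cast (by omega) (ternary H (ofLinear K) P Q)

/-- `l₃` of the structure twisted by `K`: `⟦P, Q, R⟧_K = ⟦P, Q, R⟧`. The brackets `l_k` with
`k ≥ 4` vanish. -/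
noncomputable def twistedTernary (H : g →ₗ[ℂ] g →ₗ[ℂ] V) {p q r : ℕ} (P : PLCochain V g p)
    (Q : PLCochain V g q) (R : PLCochain V g r) : PLCochain V g (p + q + r + 1) :=
  ternary H P Q R

/-- `α` is a Maurer-Cartan element of the `L∞`-algebra twisted by `K`. The summand
`Hom(∧ⁿV ⊗ V, g)` has `L∞`-degree `n + 1`, so elements of degree `1` are elements of
`Hom(∧⁰V ⊗ V, g)`; the equation is `l₁(α) + l₂(α, α) / 2! + l₃(α, α, α) / 3! = 0`. -/
def IsTwistedMaurerCartan (ρ : PreLieRep g V) (H : g →ₗ[ℂ] g →ₗ[ℂ] V) (K : V →ₗ[ℂ] g)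
    (α : PLCochain V g 0) : Prop :=
  twistedUnary ρ H K α + (1 / 2 : ℂ) • twistedBinary ρ H K α α +
    (1 / 6 : ℂ) • twistedTernary H α α α = 0

end Brackets

end PLCochain

/-! The defect `D(K)(u, v) = Ku * Kv - K(L_{Ku} v + R_{Kv} u + H(Ku, Kv))` is a polynomial in `K`:
its quadratic part is `½⟦K, K⟧` and its cubic part `⅙⟦K, K, K⟧`. The Maurer-Cartan expression of
`K'` is the Taylor expansion of `D` at `K` without the constant term, i.e. `D(K + K') - D(K)`, and
`D(K) = 0` by hypothesis. The brackets on linear maps are made explicit by `binary_ofLinear_apply`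
and `ternary_ofLinear_apply`, both iterations of `mnBracket_one_zero_apply`;
`twistedMaurerCartan_apply` compares the expansions. -/

/-- With at most one index in all, the identity is the only unshuffle. -/
theorem AlternatingMap.domCoprod_apply_of_subsingleton {R M N₁ N₂ ιa ιb : Type*} [CommRing R]
    [AddCommGroup M] [Module R M] [AddCommGroup N₁] [Module R N₁] [AddCommGroup N₂] [Module R N₂]
    [Fintype ιa] [Fintype ιb] [DecidableEq ιa] [DecidableEq ιb] [Subsingleton (ιa ⊕ ιb)]
    (a : M [⋀^ιa]→ₗ[R] N₁) (b : M [⋀^ιb]→ₗ[R] N₂) (v : ιa ⊕ ιb → M) :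
    AlternatingMap.domCoprod a b v =
      TensorProduct.tmul R (a fun i => v (Sum.inl i)) (b fun i => v (Sum.inr i)) := by
  have : Subsingleton (Equiv.Perm.ModSumCongr ιa ιb) := Quotient.instSubsingletonQuotient _
  rw [AlternatingMap.domCoprod_apply, sum_apply]
  refine (Finset.sum_eq_single (Quotient.mk'' 1)
    (fun σ _ hσ => absurd (Subsingleton.elim σ _) hσ)
    (fun h => absurd (Finset.mem_univ _) h)).trans ?_
  rw [AlternatingMap.domCoprod.summand_mk'']
  simp

namespace PLCochain

section LowDegree

variable {M : Type*} [AddCommGroup M] [Module ℂ M]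

theorem insertLast_one_zero_apply (B : PLCochain M M 1) (T : PLCochain M M 0)
    (x : Fin 1 → M) (y : M) : insertLast B T x y = B x (T ![] y) := by
  have : Subsingleton (Fin 1 ⊕ Fin 0) := (Equiv.sumEmpty _ _).subsingleton
  have h₀ : ∀ z : Fin 0 → M, z = ![] := fun z => Subsingleton.elim _ _
  have h₁ : (fun i : Fin 1 => x (finSumFinEquiv (Sum.inl i : Fin 1 ⊕ Fin 0))) = x :=
    funext fun i => congrArg x (Subsingleton.elim (α := Fin 1) _ _)
  simp [insertLast, AlternatingMap.domCoprod_apply_of_subsingleton,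
    -AlternatingMap.domCoprod_apply, h₀]
  exact congrArg (fun z => B z (T ![] y)) h₁

theorem insertLast_zero_one_apply (B : PLCochain M M 1) (T : PLCochain M M 0)
    (x : Fin 1 → M) (y : M) : insertLast T B x y = T ![] (B x y) := by
  have : Subsingleton (Fin 0 ⊕ Fin 1) := (Equiv.emptySum _ _).subsingleton
  have h₀ : ∀ z : Fin 0 → M, z = ![] := fun z => Subsingleton.elim _ _
  have h₁ : (fun i : Fin 1 => x (finSumFinEquiv (Sum.inr i : Fin 0 ⊕ Fin 1))) = x :=
    funext fun i => congrArg x (Subsingleton.elim (α := Fin 1) _ _)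
  simp [insertLast, AlternatingMap.domCoprod_apply_of_subsingleton,
    -AlternatingMap.domCoprod_apply, h₀]
  exact congrArg (fun z => T ![] (B z y)) h₁

theorem hat_zero_apply (T : PLCochain M M 0) (x : Fin 0 ⊕ Fin 1 → M) :
    hat T x = T ![] (x (Sum.inr 0)) := by
  have : Subsingleton (Fin 0 ⊕ Fin 1) := (Equiv.emptySum _ _).subsingleton
  have h₀ : ∀ z : Fin 0 → M, z = ![] := fun z => Subsingleton.elim _ _
  simp [hat, AlternatingMap.domCoprod_apply_of_subsingleton,
    -AlternatingMap.domCoprod_apply, h₀]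

theorem insertFirst_one_zero_apply (B : PLCochain M M 1) (T : PLCochain M M 0)
    (x : Fin 1 → M) (y : M) : insertFirst B T x y = B ![T ![] (x 0)] y := by
  have : Subsingleton ((Fin 0 ⊕ Fin 1) ⊕ Fin 0) :=
    ((Equiv.sumEmpty _ _).trans (Equiv.emptySum _ _)).subsingleton
  have h₁ : ∀ i : Fin 1, x i = x 0 := fun i => congrArg x (Subsingleton.elim _ _)
  have h₂ : ∀ (w : M) (z : Fin 0 → M), (Fin.cons w z : Fin 1 → M) = ![w] := by
    intro w z
    ext i
    rw [Subsingleton.elim (α := Fin 1) i 0]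
    rfl
  simp [insertFirst, AlternatingMap.domCoprod_apply_of_subsingleton,
    -AlternatingMap.domCoprod_apply, hat_zero_apply,
    splitFirst_apply, h₁, h₂]

/-- Bracketing with a linear map measures its failure to be a derivation of `B`; all signs are
`(-1)^0`. -/
theorem mnBracket_one_zero_apply (B : PLCochain M M 1) (T : PLCochain M M 0)
    (x : Fin 1 → M) (y : M) :
    mnBracket B T x y = B ![T ![] (x 0)] y + B x (T ![] y) - T ![] (B x y) := by
  -- `T` has no alternating slot, so only its last argument can receive `B`.
  have h : ∀ z : Fin 1 → M, diamond T B z y = T ![] (B z y) := by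
    intro z
    simp [diamond, insertFirst, insertLast_zero_one_apply]
  have h₁ : diamond B T x y = B ![T ![] (x 0)] y + B x (T ![] y) := by
    rw [← insertFirst_one_zero_apply, ← insertLast_one_zero_apply]
    simp [diamond]
  have h₂ : mnBracket B T x y = diamond B T x y - diamond T B x y := by
    simp [mnBracket, cast]
  rw [h₂, h₁, h]

end LowDegree

section Brackets

variable {g V : Type*} [LeftPreLieRing g] [LeftPreLieAlgebra ℂ g]
  [AddCommGroup V] [Module ℂ V]

theorem lift_ofLinear_apply (K : V →ₗ[ℂ] g) (x : Fin 0 → g × V) (a : g × V) :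
    lift (ofLinear K) x a = (K a.2, 0) := rfl

theorem semidirect_apply (ρ : PreLieRep g V) (x : Fin 1 → g × V) (b : g × V) :
    semidirect ρ x b = ((x 0).1 * b.1, ρ.L (x 0).1 b.2 + ρ.R b.1 (x 0).2) := rfl

theorem weight_apply (H : g →ₗ[ℂ] g →ₗ[ℂ] V) (x : Fin 1 → g × V) (b : g × V) :
    weight H x b = (0, H (x 0).1 b.1) := rfl

/-- A lifted map kills `g` and lands in `g`, so composites of two lifts vanish. -/
theorem binary_ofLinear_apply (ρ : PreLieRep g V) (K S : V →ₗ[ℂ] g) (x : Fin 1 → V) (v : V) :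
    binary ρ (ofLinear K) (ofLinear S) x v =
      K (x 0) * S v + S (x 0) * K v - K (ρ.L (S (x 0)) v + ρ.R (S v) (x 0))
        - S (ρ.L (K (x 0)) v + ρ.R (K v) (x 0)) := by
  have h : binary ρ (ofLinear K) (ofLinear S) x v =
      (mnBracket (mnBracket (semidirect ρ) (lift (ofLinear K))) (lift (ofLinear S))
        (fun i => (0, x i)) (0, v)).1 := by
    simp [binary, cast, restrict_apply]
  rw [h]
  -- The inner bracket has degree `1 + 0`, which is `1` only after unfolding.
  erw [mnBracket_one_zero_apply]
  simp only [mnBracket_one_zero_apply, lift_ofLinear_apply, semidirect_apply]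
  simp
  abel

/-- Since `H` takes two inputs from `g` to `V`, a surviving term has two maps inside and one
outside, the outer one giving the sign. The six orders polarise `-K(H(Ku, Kv))`. -/
theorem ternary_ofLinear_apply (H : g →ₗ[ℂ] g →ₗ[ℂ] V) (K S T : V →ₗ[ℂ] g) (x : Fin 1 → V)
    (v : V) :
    ternary H (ofLinear K) (ofLinear S) (ofLinear T) x v =
      -(K (H (S (x 0)) (T v)) + K (H (T (x 0)) (S v)) + S (H (K (x 0)) (T v))
        + S (H (T (x 0)) (K v)) + T (H (K (x 0)) (S v)) + T (H (S (x 0)) (K v))) := by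
  have h : ternary H (ofLinear K) (ofLinear S) (ofLinear T) x v =
      (mnBracket (mnBracket (mnBracket (weight H) (lift (ofLinear K))) (lift (ofLinear S)))
        (lift (ofLinear T)) (fun i => (0, x i)) (0, v)).1 := by
    simp [ternary, cast, restrict_apply]
  rw [h]
  erw [mnBracket_one_zero_apply]
  simp only [mnBracket_one_zero_apply, lift_ofLinear_apply, weight_apply]
  simp
  abel

/-- The defect of `K + S` from being an RCW Reynolds operator is the Maurer-Cartan expression of
`S` twisted by `K`, provided that `K` has no defect. -/
theorem twistedMaurerCartan_apply (ρ : PreLieRep g V) (H : g →ₗ[ℂ] g →ₗ[ℂ] V)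
    {K : V →ₗ[ℂ] g} (hK : IsRCWReynolds ρ H K) (S : V →ₗ[ℂ] g) (x : Fin 1 → V) (v : V) :
    (twistedUnary ρ H K (ofLinear S) +
      (1 / 2 : ℂ) • twistedBinary ρ H K (ofLinear S) (ofLinear S) +
      (1 / 6 : ℂ) • twistedTernary H (ofLinear S) (ofLinear S) (ofLinear S)) x v =
    (K + S) (x 0) * (K + S) v - (K + S) (ρ.L ((K + S) (x 0)) v + ρ.R ((K + S) v) (x 0)
      + H ((K + S) (x 0)) ((K + S) v)) := by
  have h : (twistedUnary ρ H K (ofLinear S) +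
      (1 / 2 : ℂ) • twistedBinary ρ H K (ofLinear S) (ofLinear S) +
      (1 / 6 : ℂ) • twistedTernary H (ofLinear S) (ofLinear S) (ofLinear S)) x v =
    binary ρ (ofLinear K) (ofLinear S) x v
      + (1 / 2 : ℂ) • ternary H (ofLinear K) (ofLinear K) (ofLinear S) x v
      + (1 / 2 : ℂ) • (binary ρ (ofLinear S) (ofLinear S) x v
        + ternary H (ofLinear K) (ofLinear S) (ofLinear S) x v)
      + (1 / 6 : ℂ) • ternary H (ofLinear S) (ofLinear S) (ofLinear S) x v := by
    rfl
  have hKx := hK (x 0) v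
  rw [h]
  simp only [binary_ofLinear_apply, ternary_ofLinear_apply]
  simp only [LinearMap.add_apply, map_add, mul_add, add_mul] at hKx ⊢
  rw [hKx]
  -- The factors `½` and `⅙` cancel the multiplicities of repeated arguments in the symmetric
  -- brackets.
  module

end Brackets

end PLCochain

theorem mainTheorem2 {g V : Type*} [LeftPreLieRing g] [LeftPreLieAlgebra ℂ g]
    [AddCommGroup V] [Module ℂ V] (ρ : PreLieRep g V) (H : g →ₗ[ℂ] g →ₗ[ℂ] V)
    (hH : IsTwoCocycle ρ H) (K : V →ₗ[ℂ] g) (hK : IsRCWReynolds ρ H K)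
    (K' : V →ₗ[ℂ] g) :
    IsRCWReynolds ρ H (K + K') ↔
      PLCochain.IsTwistedMaurerCartan ρ H K (PLCochain.ofLinear K') := by
  constructor
  · intro h
    refine AlternatingMap.ext fun x => LinearMap.ext fun v => ?_
    exact (PLCochain.twistedMaurerCartan_apply ρ H hK K' x v).trans (sub_eq_zero.mpr (h (x 0) v))
  · intro h u v
    refine sub_eq_zero.mp ((PLCochain.twistedMaurerCartan_apply ρ H hK K' ![u] v).symm.trans ?_)
    exact congrArg (fun P : PLCochain V g 1 => P ![u] v) h
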